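/- **Setting.** A dependency graph with $n$ words has nodes $0,1,\dots,n$, where $0$ is called ROOT and $1,\dots,n$ are the words, and a non-negative real weight $W(u,v)$ for each edge $u\to v$, with $W(v,v)=0$ (no self-loops) and $W(v,0)=0$ (no edge enters ROOT). A *spanning tree* is a subgraph without directed cycles in which every word has exactly one incoming edge; a *dependency tree* is a spanning tree in which exactly one edge leaves ROOT. Let $D$ be the set of dependency trees, let $\phi(t)=\prod_{(u\to v)\in t}W(u,v)$ be the weight of a tree $t$, and assume $Z_D=\sum_{t\in D}\phi(t)>0$. The marginal probability of an edge $e$ is $p(e)=\frac{1}{Z_D}\sum_{t\in D,\ e\in t}\phi(t)$. **Wilson's algorithm** on a weighted graph $w$ with root $r$. Mark $r$ as visited. Process the nodes in some fixed order containing every node; for each node $i$ do the following. Put $u:=i$; while $u$ is not visited, draw a node $v$ with probability $w(v,u)/\sum_{v'}w(v',u)$ (independently of all earlier draws), set the parent pointer $t[u]:=v$ (overwriting any earlier value) and put $u:=v$. Then put $u:=i$ again; while $u$ is not visited, mark $u$ as visited and put $u:=t[u]$. When all nodes are processed, return the edges $t[u]\to u$ for $u\neq r$. **WilsonMarginal.**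 (1) Draw a word $r$ with probability $p(\mathrm{ROOT}\to r)$. (2) Delete all edges leaving ROOT, and run Wilson's algorithm on the remaining weighted graph on the words, with root $r$. (3) Return the tree found together with the edge $\mathrm{ROOT}\to r$. **Theorem (WilsonMarginal is unbiased).** For every dependency graph with $Z_D>0$, and every order in which Wilson's algorithm processes the words, WilsonMarginal terminates almost surely, returns only dependency trees, and returns each dependency tree $t\in D$ with probability $$p(t)=\frac{\phi(t)}{Z_D}=\frac{\phi(t)}{\sum_{t'\in D}\phi(t')} .$$ -/

import Mathlib

open scoped NNReal ENNReal Topology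

noncomputable section

/-- A dependency graph of a sentence with `n` words, given by its weighted adjacency matrix:
`weight u v` is the weight of the edge `u → v`. Node `0` is ROOT, the `i`-th word is node `i.succ`.
There are no self-loops and no edge enters ROOT. -/
structure DependencyGraph (n : ℕ) where
  weight : Matrix (Fin (n + 1)) (Fin (n + 1)) ℝ≥0
  diag_zero : ∀ v, weight v v = 0
  root_col_zero : ∀ v, weight v 0 = 0

/-- A subgraph in which every word has exactly one incoming edge, recorded as the sequence of
parents: the word `i` has the single incoming edge `t i → i.succ`. -/
abbrev ParentMap (n : ℕ) := Fin n → Fin (n + 1)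

/-- `u → v` is an edge of the subgraph described by `t`. -/
def ParentMap.HasEdge {n : ℕ} (t : ParentMap n) (u v : Fin (n + 1)) : Prop :=
  ∃ i : Fin n, v = i.succ ∧ u = t i

/-- A spanning tree: every word has exactly one incoming edge (built into `ParentMap`), and there
is no directed cycle. -/
def ParentMap.IsSpanningTree {n : ℕ} (t : ParentMap n) : Prop :=
  ∀ v : Fin (n + 1), ¬ Relation.TransGen t.HasEdge v v

/-- A dependency tree: a spanning tree in which exactly one edge leaves ROOT. -/
def ParentMap.IsDependencyTree {n : ℕ} (t : ParentMap n) : Prop :=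
  t.IsSpanningTree ∧ ∃! i : Fin n, t i = 0

open Classical in
/-- The set `D` of all dependency trees over `n` words. -/
def dependencyTrees (n : ℕ) : Finset (ParentMap n) :=
  Finset.univ.filter fun t => t.IsDependencyTree

namespace DependencyGraph

variable {n : ℕ} (G : DependencyGraph n)

/-- The weight `φ(t)`: the product of the weights of the edges of `t`. -/
def treeWeight (t : ParentMap n) : ℝ≥0 := ∏ i : Fin n, G.weight (t i) i.succ

/-- The partition function `Z_D` of dependency trees. -/
def partition : ℝ≥0 := ∑ t ∈ dependencyTrees n, G.treeWeight t

/-- The marginal probability, over dependency trees, of the edge from the node `u` to the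
word `i`. -/
def marginal (u : Fin (n + 1)) (i : Fin n) : ℝ≥0 :=
  (∑ t ∈ (dependencyTrees n).filter (fun t => t i = u), G.treeWeight t) / G.partition

theorem sum_marginal_root (hZ : 0 < G.partition) :
    ∑ i : Fin n, ((G.marginal 0 i : ℝ≥0) : ℝ≥0∞) = 1 := by
  have key : ∑ i : Fin n, ∑ t ∈ (dependencyTrees n).filter (fun t => t i = 0), G.treeWeight t
      = G.partition := by
    simp only [Finset.sum_filter]
    rw [Finset.sum_comm]
    refine Finset.sum_congr rfl fun t ht => ?_
    have ht' : t.IsDependencyTree := by simpa [dependencyTrees] using ht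
    obtain ⟨i, hi, hu⟩ := ht'.2
    rw [Finset.sum_eq_single i]
    · simp [hi]
    · intro j _ hj
      exact if_neg fun h => hj (hu j h)
    · simp
  rw [← ENNReal.ofNNReal_finsetSum]
  simp only [marginal]
  rw [← Finset.sum_div, key, div_self hZ.ne', ENNReal.coe_one]

/-- The random word `r` whose edge `ROOT → r` is drawn with its marginal probability. -/
def rootDist (hZ : 0 < G.partition) : PMF (Fin n) :=
  PMF.ofFintype (fun i => (G.marginal 0 i : ℝ≥0∞)) (G.sum_marginal_root hZ)

/-- The weighted graph on the words that is left when all ROOT edges are deleted. -/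
def deleteRoot : Matrix (Fin n) (Fin n) ℝ≥0 := G.weight.submatrix Fin.succ Fin.succ

end DependencyGraph

/-! ### Wilson's algorithm -/

section Wilson

variable {V : Type} [Fintype V] [DecidableEq V]

/-- The random parent of the node `u`: the node `v` is drawn with probability proportional to the
weight `w v u` of the edge `v → u`. -/
def parentDist (w : Matrix V V ℝ≥0) (u : V) (h : ∑ v, w v u ≠ 0) : PMF V :=
  PMF.normalize (fun v => (w v u : ℝ≥0∞))
    (by rw [tsum_fintype, ← ENNReal.ofNNReal_finsetSum]; exact ENNReal.coe_ne_zero.2 h)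
    (by rw [tsum_fintype, ← ENNReal.ofNNReal_finsetSum]; exact ENNReal.coe_ne_top)

/-- The second inner loop: starting at `u`, follow the parent pointers until a visited node is
met, and mark all nodes on the way as visited. -/
def markPath {V : Type} [Fintype V] [DecidableEq V] (parent : V → V) (u : V) (visited : Finset V) : Finset V :=
  if h : u ∈ visited then visited
  else markPath parent (parent u) (insert u visited)
termination_by visitedᶜ.card
decreasing_by
  apply Finset.card_lt_card
  rw [Finset.compl_ssubset_compl]
  exact Finset.ssubset_insert h

/-- The variables of Wilson's algorithm: the nodes visited so far, the parent pointers, the start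
of the current random walk, its current position, and the starting nodes still to be processed. -/
structure WilsonState (V : Type) where
  visited : Finset V
  parent : V → V
  start : V
  cur : V
  queue : List V

/-- Running Wilson's algorithm for at most `k` steps from a given state: the law of the returned
parent pointers, `none` meaning that nothing has been returned yet. While the walk is at a node
that is not visited, a random parent is drawn, the parent pointer is overwritten and the walk
moves to the parent (if all incoming edges have weight `0`, no parent can be drawn and nothing is
ever returned). When the walk meets a visited node, the path from its start is marked as visited
and the next starting node is taken; the pointers are returned when there is none left. -/
def wilsonRun (w : Matrix V V ℝ≥0) : ℕ → WilsonState V → PMF (Option (V → V))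
  | 0, _ => PMF.pure none
  | k + 1, s =>
    if s.cur ∈ s.visited then
      match s.queue with
      | [] => PMF.pure (some s.parent)
      | i :: rest =>
        wilsonRun w k
          { visited := markPath s.parent s.start s.visited
            parent := s.parent
            start := i
            cur := i
            queue := rest }
    else if h : ∑ v, w v s.cur ≠ 0 then
      (parentDist w s.cur h).bind fun v =>
        wilsonRun w k
          { visited := s.visited
            parent := Function.update s.parent s.cur v
            start := s.start
            cur := v
            queue := s.queue }
    else PMF.pure none

/-- Wilson's algorithm on the weighted graph `w` with root `r`, processing the starting nodes in
the given order, run for at most `k` steps. At the beginning only `r` is visited; the initial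
values of the pointers are irrelevant, as every pointer but that of `r` is overwritten. -/
def wilson (w : Matrix V V ℝ≥0) (r : V) (order : List V) (k : ℕ) : PMF (Option (V → V)) :=
  wilsonRun w k { visited := {r}, parent := id, start := r, cur := r, queue := order }

end Wilson

namespace DependencyGraph

variable {n : ℕ} (G : DependencyGraph n)

/-- The tree made of the edge `ROOT → r` and of the edges `parent i → i` for the words
`i ≠ r`. -/
def attachRoot (r : Fin n) (parent : Fin n → Fin n) : ParentMap n :=
  fun i => if i = r then 0 else (parent i).succ

/-- WilsonMarginal, with at most `k` steps of Wilson's algorithm: draw the root edge `ROOT → r`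
from the marginals, delete all ROOT edges, run Wilson's algorithm with root `r` on what is left,
and add the edge `ROOT → r`. The outcome `none` means that nothing has been returned yet. -/
def wilsonMarginalRun (hZ : 0 < G.partition) (order : List (Fin n)) (k : ℕ) :
    PMF (Option (ParentMap n)) :=
  (G.rootDist hZ).bind fun r =>
    (wilson G.deleteRoot r order k).map (Option.map (attachRoot r))

/-- The probability that WilsonMarginal ever returns `t`: as an outcome, once returned, does not
change, it is the supremum over `k` of the probabilities that `t` is returned within `k` steps. -/
def wilsonMarginalProb (hZ : 0 < G.partition) (order : List (Fin n)) (t : ParentMap n) : ℝ≥0∞ :=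
  ⨆ k : ℕ, G.wilsonMarginalRun hZ order k (some t)

end DependencyGraph

end

/-! Everything reduces to Wilson's theorem: a tree `T` rooted at `r` is returned with probability
proportional to its weight. The proof guesses the probability that a run from any given state ends
in `T` and checks that the guess is preserved by every step. Let `P` be the transition matrix of the
walk and `K` the visited set. When a walk is about to start, the guess is `treeProb`: the product of
`P u (T u)` over `u ∉ K`, divided by the determinant of `1 - P` killed on `K`. It does not mention
the starting node, which is why the order is irrelevant. In the middle of a walk, `pathValue`
follows the pointers from the start: either the pointer at a node is final and agrees with `T`, or
the walk returns to that node before meeting `K` and continues as if it had just begun there. That a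
step of the walk preserves this value is `IsWalkToward.sum_pathValue`, which rests on the one-step
identity `treeProb_insert`. A run that has returned has value `1` or `0`, so the value differs from
the probability of having returned `T` within `k` steps by at most a constant times the probability
of not having returned. The latter is `O(1/k)` by an expected-time function
(`mul_wilsonRun_none_le`). The normalising determinant is never evaluated: the limits sum to `1`
over all rooted trees, and this fixes the constant. For WilsonMarginal, the marginal of `ROOT → r`
is the weight of that edge times the total weight of the trees rooted at `r`, over `Z_D`; this total
cancels against the denominator in Wilson's theorem. -/

noncomputable section

/-! ### Killed random walks and the maximum principle -/

section KilledWalk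

variable {V : Type} [Fintype V] [DecidableEq V]

/-- A parent map whose pointers all lead to the fixed point `r`. -/
def IsRootedTree (r : V) (T : V → V) : Prop := T r = r ∧ ∀ u, ∃ k : ℕ, T^[k] u = r

omit [Fintype V] in
theorem IsRootedTree.exists_rank {r : V} {T : V → V} (h : IsRootedTree r T) :
    ∃ d : V → ℕ, ∀ u, u ≠ r → d (T u) < d u := by
  classical
  refine ⟨fun u => Nat.find (h.2 u), fun u hu => ?_⟩
  have hk := Nat.find_spec (h.2 u)
  obtain ⟨m, hm⟩ : ∃ m, Nat.find (h.2 u) = m + 1 := by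
    refine Nat.exists_eq_succ_of_ne_zero fun h0 => hu ?_
    rw [h0] at hk
    exact hk
  rw [hm, Function.iterate_succ_apply] at hk
  change Nat.find (h.2 (T u)) < Nat.find (h.2 u)
  rw [hm]
  exact Nat.lt_succ_of_le (Nat.find_min' _ hk)

/-- The matrix `1 - P`, with the rows of the nodes in `K` replaced by those of the identity. -/
def killed (P : Matrix V V ℝ) (K : Finset V) : Matrix V V ℝ :=
  Matrix.of fun y v => (1 : Matrix V V ℝ) y v - if y ∈ K then 0 else P y v

theorem killed_mulVec (P : Matrix V V ℝ) (K : Finset V) (f : V → ℝ) (y : V) :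
    (killed P K).mulVec f y = f y - if y ∈ K then 0 else ∑ v, P y v * f v := by
  simp only [killed, Matrix.mulVec, dotProduct, Matrix.of_apply, sub_mul, Finset.sum_sub_distrib]
  congr 1
  · simp [Matrix.one_apply]
  · split_ifs <;> simp

/-- `P` is a Markov matrix off `r`, and the edges of `T` have positive probability. -/
structure IsWalkToward (r : V) (P : Matrix V V ℝ) (T : V → V) : Prop where
  nonneg : ∀ u v, 0 ≤ P u v
  sum_eq_one : ∀ u, u ≠ r → ∑ v, P u v = 1
  tree : IsRootedTree r T
  pos : ∀ u, u ≠ r → 0 < P u (T u)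

namespace IsWalkToward

variable {r : V} {P : Matrix V V ℝ} {T : V → V} (hP : IsWalkToward r P T)
include hP

-- Maximum principle: a positive maximum would propagate along the edges of `T`, which have positive
-- probability, down to `r`, where the function is at most `0`.
omit [DecidableEq V] in
theorem le_zero_of_subharmonic {K : Finset V} (hr : r ∈ K) {f : V → ℝ}
    (hK : ∀ y ∈ K, f y ≤ 0) (hf : ∀ y ∉ K, f y ≤ ∑ v, P y v * f v) (y : V) : f y ≤ 0 := by
  have : Nonempty V := ⟨r⟩
  obtain ⟨z, hz⟩ := Finite.exists_max f
  refine (hz y).trans ?_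
  by_contra! hpos
  have step : ∀ u, f u = f z → f (T u) = f z := by
    intro u hu
    have huK : u ∉ K := fun h => (hK u h).not_gt (hu ▸ hpos)
    have hur : u ≠ r := fun h => huK (h ▸ hr)
    have hsum : ∑ v, P u v * (f z - f v) ≤ 0 := by
      have := hf u huK
      simp only [mul_sub, Finset.sum_sub_distrib, ← Finset.sum_mul, hP.sum_eq_one u hur]
      linarith
    have hle := (Finset.single_le_sum (f := fun v => P u v * (f z - f v))
      (fun v _ => mul_nonneg (hP.nonneg u v) (sub_nonneg.2 (hz v)))
      (Finset.mem_univ (T u))).trans hsum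
    have h0 : f z - f (T u) ≤ 0 := by
      by_contra! h
      exact hle.not_gt (mul_pos (hP.pos u hur) h)
    exact le_antisymm (hz _) (by linarith)
  obtain ⟨k, hk⟩ := hP.tree.2 z
  have hiter : ∀ k, f (T^[k] z) = f z := by
    intro k
    induction k with
    | zero => rfl
    | succ k ih => rw [Function.iterate_succ_apply']; exact step _ ih
  have := hiter k
  rw [hk] at this
  exact (hK r hr).not_gt (this ▸ hpos)

/-- A vector in the kernel is harmonic off `K` and zero on `K`, so the maximum principle applies to
it and to its negative. -/
theorem det_killed_ne_zero {K : Finset V} (hr : r ∈ K) : (killed P K).det ≠ 0 := by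
  intro h
  obtain ⟨f, hf0, hf⟩ := Matrix.exists_mulVec_eq_zero_iff.2 h
  have hy : ∀ y, (f y - if y ∈ K then 0 else ∑ v, P y v * f v) = 0 := fun y => by
    rw [← killed_mulVec, hf]; rfl
  have hK : ∀ y ∈ K, f y = 0 := fun y hyK => by simpa [hyK] using hy y
  have hn : ∀ y ∉ K, f y = ∑ v, P y v * f v := fun y hyK => by
    have := hy y
    rw [if_neg hyK] at this
    linarith
  refine hf0 (funext fun y => le_antisymm ?_ ?_)
  · exact hP.le_zero_of_subharmonic hr (fun y h => (hK y h).le) (fun y h => (hn y h).le) y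
  · have := hP.le_zero_of_subharmonic hr (f := fun v => -f v)
      (fun y h => by simp [hK y h])
      (fun y h => by simp only [mul_neg, Finset.sum_neg_distrib, hn y h, le_refl]) y
    simpa using this

/-- A nonnegative function that decreases by `1` on average in each step of the walk. -/
theorem exists_expected_time :
    ∃ g : V → ℝ, (∀ y, 0 ≤ g y) ∧ ∀ y, y ≠ r → ∑ v, P y v * g v = g y - 1 := by
  have hdet := hP.det_killed_ne_zero (Finset.mem_singleton_self r)
  have hunit : IsUnit (killed P {r}).det := isUnit_iff_ne_zero.2 hdet
  -- Each step off `r` costs `1`; inverting the killed matrix gives the expected total cost until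
  -- `r` is met.
  set b : V → ℝ := fun y => if y = r then 0 else 1 with hb
  set g := (killed P {r})⁻¹.mulVec b with hg
  have hy : ∀ y, (g y - if y ∈ ({r} : Finset V) then 0 else ∑ v, P y v * g v) = b y := fun y => by
    rw [← killed_mulVec, hg, Matrix.mulVec_mulVec, Matrix.mul_nonsing_inv _ hunit,
      Matrix.one_mulVec]
  have hn : ∀ y, y ≠ r → ∑ v, P y v * g v = g y - 1 := fun y h => by
    have := hy y
    simp only [Finset.mem_singleton, h, if_false, hb] at this
    linarith
  refine ⟨g, fun y => ?_, hn⟩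
  have := hP.le_zero_of_subharmonic (Finset.mem_singleton_self r) (f := fun v => -g v)
    (fun y h => by
      have h' := hy y
      rw [if_pos h] at h'
      simp only [Finset.mem_singleton] at h
      simp only [hb, h, if_true] at h'
      rw [h]; linarith)
    (fun y h => by
      simp only [Finset.mem_singleton] at h
      simp only [mul_neg, Finset.sum_neg_distrib, hn y h]
      linarith) y
  simpa using this

end IsWalkToward

/-! ### Hitting probabilities and determinants -/

/-- The probability that the walk started at `v` meets `x` before `K`. -/
def hit (P : Matrix V V ℝ) (K : Finset V) (x v : V) : ℝ :=
  (killed P (insert x K)).adjugate v x / (killed P (insert x K)).det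

/-- `hit P K x` is column `x` of the inverse of the killed matrix, written with the adjugate. -/
theorem hit_equation {P : Matrix V V ℝ} {K : Finset V} {x : V}
    (h : (killed P (insert x K)).det ≠ 0) (y : V) :
    (hit P K x y - if y ∈ insert x K then 0 else ∑ v, P y v * hit P K x v)
      = if y = x then 1 else 0 := by
  rw [← killed_mulVec P (insert x K) (hit P K x)]
  have := congrFun (congrFun (Matrix.mul_adjugate (killed P (insert x K))) y) x
  rw [Matrix.mul_apply] at this
  simp only [Matrix.mulVec, dotProduct, hit, ← mul_div_assoc, ← Finset.sum_div]
  rw [this]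
  by_cases hyx : y = x <;> simp [hyx, h]

theorem hit_self {P : Matrix V V ℝ} {K : Finset V} {x : V}
    (h : (killed P (insert x K)).det ≠ 0) : hit P K x x = 1 := by
  simpa using hit_equation h x

theorem hit_of_mem {P : Matrix V V ℝ} {K : Finset V} {x y : V}
    (h : (killed P (insert x K)).det ≠ 0) (hy : y ∈ K) (hyx : y ≠ x) : hit P K x y = 0 := by
  simpa [hy, hyx] using hit_equation h y

theorem hit_of_notMem {P : Matrix V V ℝ} {K : Finset V} {x y : V}
    (h : (killed P (insert x K)).det ≠ 0) (hy : y ∉ K) (hyx : y ≠ x) :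
    ∑ v, P y v * hit P K x v = hit P K x y := by
  have := hit_equation h y
  simp only [Finset.mem_insert, hyx, hy, or_self, if_false] at this
  linarith

/-- The two matrices differ only in row `x`. Expanding along that row, the cofactors are the hitting
probabilities times the determinant; the last factor is the probability of not returning to `x`
before `K`. -/
theorem det_killed_eq (P : Matrix V V ℝ) {K : Finset V} {x : V} (hx : x ∉ K)
    (h : (killed P (insert x K)).det ≠ 0) :
    (killed P K).det = (killed P (insert x K)).det * (1 - ∑ v, P x v * hit P K x v) := by
  set M := killed P (insert x K) with hM
  have hrow : killed P K = M.updateRow x (fun v => (1 : Matrix V V ℝ) x v - P x v) := by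
    ext y v
    by_cases hy : y = x
    · subst hy
      simp [killed, hx]
    · simp [hM, killed, hy]
  have hexp : ∀ ρ : V → ℝ, (M.updateRow x ρ).det = ∑ v, ρ v * M.adjugate v x := by
    intro ρ
    have := congrFun (Matrix.cramer_eq_adjugate_mulVec M.transpose ρ) x
    rw [Matrix.cramer_transpose_apply, ← Matrix.adjugate_transpose] at this
    rw [this]
    simp [Matrix.mulVec, dotProduct, mul_comm]
  rw [hrow, hexp]
  have h1 : ∀ v, M.adjugate v x = M.det * hit P K x v := fun v => by
    rw [hit, ← hM]; field_simp
  simp only [h1, sub_mul, Finset.sum_sub_distrib]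
  have h2 : ∑ v, (1 : Matrix V V ℝ) x v * (M.det * hit P K x v) = M.det := by
    simp [Matrix.one_apply, hit_self h]
  rw [h2, mul_sub, mul_one, Finset.mul_sum]
  congr 1
  exact Finset.sum_congr rfl fun v _ => by ring

/-- The probability that Wilson's algorithm ends with the pointers of `T` at the nodes outside
`K`, when the nodes in `K` are visited. -/
def treeProb (P : Matrix V V ℝ) (T : V → V) (K : Finset V) : ℝ :=
  (∏ u ∈ Kᶜ, P u (T u)) / (killed P K).det

theorem treeProb_univ (P : Matrix V V ℝ) (T : V → V) : treeProb P T Finset.univ = 1 := by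
  have : killed P Finset.univ = 1 := by ext; simp [killed]
  simp [treeProb, this]

/-- First-step decomposition at `x`: either the step goes to `T x` and this pointer is kept, or the
walk returns to `x` and starts afresh. -/
theorem treeProb_insert {P : Matrix V V ℝ} (T : V → V) {K : Finset V} {x : V} (hx : x ∉ K)
    (hK : (killed P K).det ≠ 0) (h : (killed P (insert x K)).det ≠ 0) :
    P x (T x) * treeProb P T (insert x K) + (∑ v, P x v * hit P K x v) * treeProb P T K
      = treeProb P T K := by
  have hd := det_killed_eq P hx h
  have hprod : ∏ u ∈ Kᶜ, P u (T u) = P x (T x) * ∏ u ∈ (insert x K)ᶜ, P u (T u) := by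
    rw [Finset.compl_insert]
    exact (Finset.mul_prod_erase Kᶜ (fun u => P u (T u)) (Finset.mem_compl.2 hx)).symm
  have h3 : P x (T x) * treeProb P T (insert x K)
      = treeProb P T K * (1 - ∑ v, P x v * hit P K x v) := by
    rw [treeProb, treeProb, hprod, ← mul_div_assoc, div_mul_eq_mul_div, div_eq_div_iff h hK, hd]
    ring
  rw [h3]
  ring

/-! ### The value of an unfinished walk -/

/-- The path of the pointers `t` from `x` to its first visit of `y`, which meets no node twice and
no node of `K` before `y`. -/
inductive PointerPath (t : V → V) (y : V) : Finset V → V → Prop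
  | refl (K : Finset V) : PointerPath t y K y
  | step {K : Finset V} {x : V} (hne : x ≠ y) (hx : x ∉ K)
      (h : PointerPath t y (insert x K) (t x)) : PointerPath t y K x

-- Loop erasure is automatic: if `v` already lies on the path, the path now stops there; otherwise
-- it is extended from `y` to `v`.
omit [Fintype V] in
theorem PointerPath.update {t : V → V} {y x : V} {K : Finset V} (h : PointerPath t y K x)
    (hy : y ∉ K) (v : V) : PointerPath (Function.update t y v) v K x := by
  induction h with
  | refl K =>
    by_cases hv : y = v
    · subst hv; exact .refl K
    · refine .step hv hy ?_
      rw [Function.update_self]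
      exact .refl _
  | @step K x hne hx _ ih =>
    by_cases hv : x = v
    · subst hv; exact .refl K
    · refine .step hv hx ?_
      rw [Function.update_of_ne hne]
      exact ih (by simp [hy, Ne.symm hne])

/-- The probability that the current walk of Wilson's algorithm, which is at `y` and has left the
pointers `t` on its path from `x`, and all later walks end with the pointers of `T`. -/
def pathValue (P : Matrix V V ℝ) (T t : V → V) (y : V) (K : Finset V) (x : V) : ℝ :=
  if x = y then treeProb P T K
  -- A default value, never met along a `PointerPath`.
  else if h : x ∈ K then 0
  else (if t x = T x then pathValue P T t y (insert x K) (t x) else 0)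
    + hit P K x y * treeProb P T K
termination_by Kᶜ.card
decreasing_by
  apply Finset.card_lt_card
  rw [Finset.compl_ssubset_compl]
  exact Finset.ssubset_insert h

theorem pathValue_self (P : Matrix V V ℝ) (T t : V → V) (y : V) (K : Finset V) :
    pathValue P T t y K y = treeProb P T K := by
  rw [pathValue, if_pos rfl]

theorem pathValue_step (P : Matrix V V ℝ) (T t : V → V) {x y : V} {K : Finset V} (hne : x ≠ y)
    (hx : x ∉ K) : pathValue P T t y K x
      = (if t x = T x then pathValue P T t y (insert x K) (t x) else 0)
        + hit P K x y * treeProb P T K := by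
  rw [pathValue, if_neg hne, dif_neg hx]

/-- Induction along the pointer path. `X` collects the path nodes already passed and moved into `K`.
A return to such a node is accounted for by the `hit` term of that node, so it must count as `0`
deeper in the recursion. The ranks `d` show that this loses nothing: the passed edges are edges of
`T`, and `T` has no cycle. The tree `T₀` only provides invertibility; `T` itself may have
probability zero. -/
theorem IsWalkToward.sum_pathValue {r : V} {P : Matrix V V ℝ} {T₀ T : V → V}
    (hP : IsWalkToward r P T₀) {d : V → ℕ} (hd : ∀ u, u ≠ r → d (T u) < d u)
    {t : V → V} {y x : V} {K : Finset V} (h : PointerPath t y K x) (hy : y ∉ K) (hr : r ∈ K)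
    {X : Finset V} (hX : X ⊆ K) (hdX : ∀ z ∈ X, d x < d z) :
    ∑ v, P y v * (if v ∈ X then 0 else pathValue P T (Function.update t y v) v K x)
      = pathValue P T t y K x := by
  induction h generalizing X with
  | refl K =>
    have hdet := hP.det_killed_ne_zero (Finset.mem_insert_of_mem hr : r ∈ insert y K)
    -- The rank drops from `y` to `T y`, while the nodes of `X` have larger rank than `y`.
    have hTX : T y ∉ X := fun hT =>
      absurd (hdX _ hT) (hd y (fun e => hy (e ▸ hr))).not_gt
    have hne : y ≠ T y := fun e => by
      have := hd y (fun e => hy (e ▸ hr))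
      rw [← e] at this
      exact this.false
    rw [pathValue_self, ← treeProb_insert T hy (hP.det_killed_ne_zero hr) hdet, Finset.sum_mul]
    have hterm : ∀ v, P y v * (if v ∈ X then 0 else pathValue P T (Function.update t y v) v K y)
        = (if v = T y then P y v * treeProb P T (insert y K) else 0)
          + P y v * hit P K y v * treeProb P T K := by
      intro v
      by_cases hvX : v ∈ X
      · have hvy : v ≠ y := fun e => hy (e ▸ hX hvX)
        have hvT : v ≠ T y := fun e => hTX (e ▸ hvX)
        simp [hvX, hvT, hit_of_mem hdet (hX hvX) hvy]
      · rw [if_neg hvX]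
        by_cases hvy : v = y
        · subst hvy
          simp [pathValue_self, hit_self hdet, hne]
        · rw [pathValue_step P T _ (Ne.symm hvy) hy, Function.update_self, pathValue_self]
          by_cases hT : v = T y
          · simp only [hT, if_true]; ring
          · simp only [hT, if_false]; ring
    simp [hterm, Finset.sum_add_distrib]
  | @step K x hne hx hpath ih =>
    have hdet := hP.det_killed_ne_zero (Finset.mem_insert_of_mem hr : r ∈ insert x K)
    have hxX : x ∉ X := fun hxX => hx (hX hxX)
    rw [pathValue_step P T t hne hx, ← hit_of_notMem hdet hy (Ne.symm hne), Finset.sum_mul]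
    have hrec : (if t x = T x then pathValue P T t y (insert x K) (t x) else 0)
        = ∑ v, P y v * (if v ∈ insert x X then 0 else if t x = T x then
            pathValue P T (Function.update t y v) v (insert x K) (t x) else 0) := by
      split_ifs with hT
      · refine (ih (by simp [hy, Ne.symm hne]) (Finset.mem_insert_of_mem hr)
          (Finset.insert_subset_insert x hX) fun z hz => ?_).symm
        have hlt : d (t x) < d x := hT ▸ hd x (fun e => hx (e ▸ hr))
        rcases Finset.mem_insert.1 hz with rfl | hz
        · exact hlt
        · exact hlt.trans (hdX z hz)
      · simp
    rw [hrec, ← Finset.sum_add_distrib]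
    refine Finset.sum_congr rfl fun v _ => ?_
    -- For `v = x` the loop closes at `x`: the recursive term is dropped and `hit P K x x = 1`
    -- supplies the whole value. For `v ∈ X` both terms vanish.
    by_cases hvx : v = x
    · subst hvx
      simp [hxX, pathValue_self, hit_self hdet]
    · by_cases hvX : v ∈ X
      · simp [hvX, hit_of_mem hdet (hX hvX) hvx]
      · rw [if_neg hvX, if_neg (by simp [hvx, hvX]),
          pathValue_step P T _ (Ne.symm hvx) hx, Function.update_of_ne hne]
        ring

end KilledWalk

/-! ### States of Wilson's algorithm: invariant and value -/

section WilsonLaw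

variable {V : Type} [Fintype V] [DecidableEq V]

theorem markPath_of_mem {t : V → V} {x : V} {K : Finset V} (h : x ∈ K) : markPath t x K = K := by
  rw [markPath, dif_pos h]

theorem markPath_of_notMem {t : V → V} {x : V} {K : Finset V} (h : x ∉ K) :
    markPath t x K = markPath t (t x) (insert x K) := by
  rw [markPath, dif_neg h]

theorem subset_markPath (t : V → V) (x : V) (K : Finset V) : K ⊆ markPath t x K := by
  induction x, K using markPath.induct (parent := t) with
  | case1 x K h => rw [markPath_of_mem h]
  | case2 x K h ih =>
    rw [markPath_of_notMem h]
    exact (Finset.subset_insert x K).trans ih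

theorem self_mem_markPath (t : V → V) (x : V) (K : Finset V) : x ∈ markPath t x K := by
  by_cases h : x ∈ K
  · exact subset_markPath t x K h
  · rw [markPath_of_notMem h]
    exact subset_markPath _ _ _ (Finset.mem_insert_self x K)

/-- Once the walk stands in `K`, it can return to no path node before meeting `K`, so all `hit`
terms vanish and only the agreement of the pointers with `T` remains. -/
theorem PointerPath.pathValue_eq {r : V} {P : Matrix V V ℝ} {T₀ : V → V}
    (hP : IsWalkToward r P T₀) (T : V → V) {t : V → V} {y x : V} {K : Finset V}
    (h : PointerPath t y K x) (hy : y ∈ K) (hr : r ∈ K) :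
    pathValue P T t y K x = if ∀ u ∈ markPath t x K, u ∈ K ∨ t u = T u
      then treeProb P T (markPath t x K) else 0 := by
  induction h with
  | refl K =>
    rw [pathValue_self, markPath_of_mem hy, if_pos fun u hu => Or.inl hu]
  | @step K x hne hx _ ih =>
    have hrx : r ∈ insert x K := Finset.mem_insert_of_mem hr
    rw [pathValue_step P T t hne hx, hit_of_mem (hP.det_killed_ne_zero hrx) hy (Ne.symm hne),
      zero_mul, add_zero, ih (Finset.mem_insert_of_mem hy) hrx, markPath_of_notMem hx]
    have hxm := subset_markPath t (t x) _ (Finset.mem_insert_self x K)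
    by_cases hT : t x = T x
    · rw [if_pos hT]
      congr 1
      refine propext (forall₂_congr fun u _ => ?_)
      rw [Finset.mem_insert]
      constructor
      · rintro ((rfl | h) | h)
        · exact Or.inr hT
        · exact Or.inl h
        · exact Or.inr h
      · rintro (h | h)
        · exact Or.inl (Or.inr h)
        · exact Or.inr h
    · rw [if_neg hT, if_neg]
      exact fun h => (h x hxm).elim hx hT

/-- The pointers `t` lead from `u` to `r`. -/
def LeadsTo (t : V → V) (r u : V) : Prop := ∃ k : ℕ, t^[k] u = r

omit [Fintype V] [DecidableEq V] in
theorem LeadsTo.of_apply {t : V → V} {r u : V} (h : LeadsTo t r (t u)) : LeadsTo t r u := by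
  obtain ⟨k, hk⟩ := h
  exact ⟨k + 1, hk⟩

theorem LeadsTo.congr {t t' : V → V} {r u : V} {K : Finset V} (hK : ∀ z ∈ K, t z ∈ K)
    (heq : ∀ z ∈ K, t' z = t z) (hu : u ∈ K) (h : LeadsTo t r u) : LeadsTo t' r u := by
  obtain ⟨k, hk⟩ := h
  induction k generalizing u with
  | zero => exact ⟨0, hk⟩
  | succ k ih =>
    apply LeadsTo.of_apply
    rw [heq u hu]
    exact ih (hK u hu) hk

theorem PointerPath.leadsTo {t : V → V} {r y x : V} {K : Finset V} (h : PointerPath t y K x)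
    (hy : y ∈ K) (hyr : LeadsTo t r y) :
    LeadsTo t r x ∧ ∀ u ∈ markPath t x K, u ∈ K ∨ (LeadsTo t r u ∧ t u ∈ markPath t x K) := by
  induction h with
  | refl K => exact ⟨hyr, fun u hu => Or.inl (by rwa [markPath_of_mem hy] at hu)⟩
  | @step K x hne hx _ ih =>
    obtain ⟨h1, h2⟩ := ih (Finset.mem_insert_of_mem hy)
    refine ⟨h1.of_apply, fun u hu => ?_⟩
    rw [markPath_of_notMem hx] at hu ⊢
    rcases h2 u hu with hu' | hu'
    · rcases Finset.mem_insert.1 hu' with rfl | hu'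
      · exact Or.inr ⟨h1.of_apply, self_mem_markPath _ _ _⟩
      · exact Or.inl hu'
    · exact Or.inr hu'

namespace WilsonState

/-- The state after marking the path of a finished walk, with the next starting node `i`. -/
def mark (s : WilsonState V) (i : V) (rest : List V) : WilsonState V where
  visited := markPath s.parent s.start s.visited
  parent := s.parent
  start := i
  cur := i
  queue := rest

/-- The state after a step of the walk to the node `v`. -/
def move (s : WilsonState V) (v : V) : WilsonState V where
  visited := s.visited
  parent := Function.update s.parent s.cur v
  start := s.start
  cur := v
  queue := s.queue

/-- The invariant of Wilson's algorithm with root `r`. -/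
structure Valid (r : V) (s : WilsonState V) : Prop where
  root_mem : r ∈ s.visited
  parent_root : s.parent r = r
  closed : ∀ u ∈ s.visited, s.parent u ∈ s.visited
  leadsTo : ∀ u ∈ s.visited, LeadsTo s.parent r u
  path : PointerPath s.parent s.cur s.visited s.start
  cover : ∀ u, u ∈ s.visited ∨ u = s.start ∨ u ∈ s.queue

namespace Valid

variable {r : V} {s : WilsonState V} (hs : s.Valid r)
include hs

theorem mark {i : V} {rest : List V} (hcur : s.cur ∈ s.visited) (hq : s.queue = i :: rest) :
    (s.mark i rest).Valid r where
  root_mem := subset_markPath _ _ _ hs.root_mem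
  parent_root := hs.parent_root
  closed u hu := by
    rcases (hs.path.leadsTo hcur (hs.leadsTo _ hcur)).2 u hu with h | h
    · exact subset_markPath _ _ _ (hs.closed u h)
    · exact h.2
  leadsTo u hu := by
    rcases (hs.path.leadsTo hcur (hs.leadsTo _ hcur)).2 u hu with h | h
    · exact hs.leadsTo u h
    · exact h.1
  path := .refl _
  cover u := by
    rcases hs.cover u with h | h | h
    · exact Or.inl (subset_markPath _ _ _ h)
    · exact Or.inl (h ▸ self_mem_markPath _ _ _)
    · rw [hq, List.mem_cons] at h
      exact Or.inr h

theorem move (hcur : s.cur ∉ s.visited) (v : V) : (s.move v).Valid r := by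
  have hne : ∀ u ∈ s.visited, Function.update s.parent s.cur v u = s.parent u := fun u hu =>
    Function.update_of_ne (fun (e : u = s.cur) => hcur (e ▸ hu)) _ _
  exact
    { root_mem := hs.root_mem
      parent_root := (hne r hs.root_mem).trans hs.parent_root
      closed := fun u hu => by
        change Function.update s.parent s.cur v u ∈ s.visited
        rw [hne u hu]
        exact hs.closed u hu
      leadsTo := fun u hu => (hs.leadsTo u hu).congr hs.closed hne hu
      path := hs.path.update hcur v
      cover := hs.cover }

theorem markPath_eq_univ (hq : s.queue = []) :
    markPath s.parent s.start s.visited = Finset.univ := by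
  refine Finset.eq_univ_iff_forall.2 fun u => ?_
  rcases hs.cover u with h | h | h
  · exact subset_markPath _ _ _ h
  · exact h ▸ self_mem_markPath _ _ _
  · simp [hq] at h

theorem isRootedTree (hcur : s.cur ∈ s.visited) (hq : s.queue = []) :
    IsRootedTree r s.parent := by
  refine ⟨hs.parent_root, fun u => ?_⟩
  have hu : u ∈ markPath s.parent s.start s.visited := by simp [hs.markPath_eq_univ hq]
  rcases (hs.path.leadsTo hcur (hs.leadsTo _ hcur)).2 u hu with h | h
  · exact hs.leadsTo u h
  · exact h.1

end Valid

/-- The probability that a run of Wilson's algorithm from the state `s` returns `T`. -/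
def value (P : Matrix V V ℝ) (T : V → V) (s : WilsonState V) : ℝ :=
  if ∀ u ∈ s.visited, s.parent u = T u
    then pathValue P T s.parent s.cur s.visited s.start else 0

theorem exists_abs_value_le (P : Matrix V V ℝ) (T : V → V) :
    ∃ C, ∀ s : WilsonState V, |s.value P T| ≤ C := by
  -- The value ignores the queue, the only component with infinitely many possibilities.
  let f : Finset V × (V → V) × V × V → ℝ := fun a =>
    |value P T ⟨a.1, a.2.1, a.2.2.1, a.2.2.2, []⟩|
  obtain ⟨C, hC⟩ := (Set.finite_range f).bddAbove
  exact ⟨C, fun s => hC ⟨(s.visited, s.parent, s.start, s.cur), rfl⟩⟩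

variable {r : V} {P : Matrix V V ℝ} {T₀ T : V → V} (hP : IsWalkToward r P T₀)
  {s : WilsonState V} (hs : s.Valid r)
include hP hs

theorem value_of_mem (hcur : s.cur ∈ s.visited) :
    s.value P T = if ∀ u ∈ markPath s.parent s.start s.visited, s.parent u = T u
      then treeProb P T (markPath s.parent s.start s.visited) else 0 := by
  rw [value, hs.path.pathValue_eq hP T hcur hs.root_mem, ← ite_and]
  congr 1
  refine propext ⟨fun h u hu => (h.2 u hu).elim (h.1 u) id, fun h =>
    ⟨fun u hu => h u (subset_markPath _ _ _ hu), fun u hu => Or.inr (h u hu)⟩⟩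

theorem value_mark (hcur : s.cur ∈ s.visited) (i : V) (rest : List V) :
    (s.mark i rest).value P T = s.value P T := by
  rw [value_of_mem hP hs hcur, value]
  simp only [mark, pathValue_self]

theorem value_last (hcur : s.cur ∈ s.visited) (hq : s.queue = []) :
    s.value P T = if s.parent = T then 1 else 0 := by
  rw [value_of_mem hP hs hcur, hs.markPath_eq_univ hq, treeProb_univ]
  congr 1
  simp [funext_iff]

theorem sum_value_move (hT : IsRootedTree r T) (hcur : s.cur ∉ s.visited) :
    ∑ v, P s.cur v * (s.move v).value P T = s.value P T := by
  obtain ⟨d, hd⟩ := hT.exists_rank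
  have key := hP.sum_pathValue hd hs.path hcur hs.root_mem (X := ∅) (by simp) (by simp)
  simp only [Finset.notMem_empty, if_false] at key
  have hcond : ∀ v, (∀ u ∈ s.visited, Function.update s.parent s.cur v u = T u) ↔
      ∀ u ∈ s.visited, s.parent u = T u := fun v => forall₂_congr fun u hu => by
    rw [Function.update_of_ne fun (e : u = s.cur) => hcur (e ▸ hu)]
  simp only [value, move, hcond]
  split_ifs
  · exact key
  · simp

end WilsonState

/-! ### One step of a run, and the shape of its outcomes -/

/-- The transition matrix of the random walk of Wilson's algorithm. -/
def transition (w : Matrix V V ℝ≥0) : Matrix V V ℝ :=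
  Matrix.of fun u v => ((w v u / ∑ v', w v' u : ℝ≥0) : ℝ)

omit [DecidableEq V] in
theorem toReal_parentDist (w : Matrix V V ℝ≥0) (u : V) (h : ∑ v, w v u ≠ 0) (v : V) :
    (parentDist w u h v).toReal = transition w u v := by
  rw [parentDist, PMF.normalize_apply, tsum_fintype, ← ENNReal.ofNNReal_finsetSum,
    ← div_eq_mul_inv, ← ENNReal.coe_div h]
  rfl

theorem wilsonRun_last (w : Matrix V V ℝ≥0) (k : ℕ) {s : WilsonState V}
    (hcur : s.cur ∈ s.visited) (hq : s.queue = []) :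
    wilsonRun w (k + 1) s = PMF.pure (some s.parent) := by
  rw [wilsonRun, if_pos hcur, hq]

theorem wilsonRun_mark (w : Matrix V V ℝ≥0) (k : ℕ) {s : WilsonState V}
    (hcur : s.cur ∈ s.visited) {i : V} {rest : List V} (hq : s.queue = i :: rest) :
    wilsonRun w (k + 1) s = wilsonRun w k (s.mark i rest) := by
  rw [wilsonRun, if_pos hcur, hq]
  rfl

theorem wilsonRun_move (w : Matrix V V ℝ≥0) (k : ℕ) {s : WilsonState V}
    (hcur : s.cur ∉ s.visited) (h : ∑ v, w v s.cur ≠ 0) :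
    wilsonRun w (k + 1) s = (parentDist w s.cur h).bind fun v => wilsonRun w k (s.move v) := by
  rw [wilsonRun, if_neg hcur, dif_pos h]
  rfl

theorem wilsonRun_stuck (w : Matrix V V ℝ≥0) (k : ℕ) {s : WilsonState V}
    (hcur : s.cur ∉ s.visited) (h : ∑ v, w v s.cur = 0) :
    wilsonRun w (k + 1) s = PMF.pure none := by
  rw [wilsonRun, if_neg hcur, dif_neg (not_not.2 h)]

theorem toReal_wilsonRun_move (w : Matrix V V ℝ≥0) (k : ℕ) {s : WilsonState V}
    (hcur : s.cur ∉ s.visited) (h : ∑ v, w v s.cur ≠ 0) (o : Option (V → V)) :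
    (wilsonRun w (k + 1) s o).toReal
      = ∑ v, transition w s.cur v * (wilsonRun w k (s.move v) o).toReal := by
  rw [wilsonRun_move w k hcur h, PMF.bind_apply, tsum_fintype, ENNReal.toReal_sum]
  · simp only [ENNReal.toReal_mul, toReal_parentDist]
  · exact fun v _ => ENNReal.mul_ne_top (PMF.apply_ne_top _ _) (PMF.apply_ne_top _ _)

theorem wilsonRun_mono (w : Matrix V V ℝ≥0) (T : V → V) (k : ℕ) (s : WilsonState V) :
    wilsonRun w k s (some T) ≤ wilsonRun w (k + 1) s (some T) := by
  induction k generalizing s with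
  | zero => simp [wilsonRun]
  | succ k ih =>
    by_cases hcur : s.cur ∈ s.visited
    · rcases hq : s.queue with _ | ⟨i, rest⟩
      · rw [wilsonRun_last w _ hcur hq, wilsonRun_last w _ hcur hq]
      · rw [wilsonRun_mark w _ hcur hq, wilsonRun_mark w _ hcur hq]
        exact ih _
    · by_cases h : ∑ v, w v s.cur = 0
      · rw [wilsonRun_stuck w _ hcur h, wilsonRun_stuck w _ hcur h]
      · rw [wilsonRun_move w _ hcur h, wilsonRun_move w _ hcur h, PMF.bind_apply, PMF.bind_apply]
        exact ENNReal.tsum_le_tsum fun v => mul_le_mul_right (ih _) _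

theorem isRootedTree_of_wilsonRun_ne_zero (w : Matrix V V ℝ≥0) {r : V} {T : V → V} (k : ℕ)
    {s : WilsonState V} (hs : s.Valid r) (h : wilsonRun w k s (some T) ≠ 0) :
    IsRootedTree r T := by
  induction k generalizing s with
  | zero => simp [wilsonRun] at h
  | succ k ih =>
    by_cases hcur : s.cur ∈ s.visited
    · rcases hq : s.queue with _ | ⟨i, rest⟩
      · rw [wilsonRun_last w _ hcur hq] at h
        have hT : T = s.parent := by simpa [PMF.pure_apply] using h
        exact hT ▸ hs.isRootedTree hcur hq
      · rw [wilsonRun_mark w _ hcur hq] at h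
        exact ih (hs.mark hcur hq) h
    · by_cases hw : ∑ v, w v s.cur = 0
      · simp [wilsonRun_stuck w _ hcur hw] at h
      · rw [wilsonRun_move w _ hcur hw, PMF.bind_apply, Ne, ENNReal.tsum_eq_zero, not_forall] at h
        obtain ⟨v, hv⟩ := h
        exact ih (hs.move hcur v) (right_ne_zero_of_mul hv)

/-! ### Almost sure termination and the limit law -/

section Convergence

variable {w : Matrix V V ℝ≥0} {r : V} {T₀ : V → V} (hT₀ : IsRootedTree r T₀)
  (hpos : ∀ u, u ≠ r → 0 < w (T₀ u) u)
include hT₀ hpos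

omit [DecidableEq V] hT₀ in
theorem sum_weight_ne_zero {u : V} (hu : u ≠ r) : ∑ v, w v u ≠ 0 :=
  ((hpos u hu).trans_le (Finset.single_le_sum (f := fun v => w v u)
    (fun _ _ => zero_le) (Finset.mem_univ (T₀ u)))).ne'

theorem isWalkToward_transition : IsWalkToward r (transition w) T₀ where
  nonneg _ _ := NNReal.coe_nonneg _
  sum_eq_one u hu := by
    simp only [transition, Matrix.of_apply]
    rw [← NNReal.coe_sum, ← Finset.sum_div, div_self (sum_weight_ne_zero hpos hu),
      NNReal.coe_one]
  tree := hT₀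
  pos u hu := by
    simp only [transition, Matrix.of_apply]
    exact NNReal.coe_pos.2
      (div_pos (hpos u hu) (pos_iff_ne_zero.2 (sum_weight_ne_zero hpos hu)))

/-- The value is preserved by every step and is exact when the run returns; the error comes only
from unfinished runs, each contributing at most `C`. -/
theorem abs_value_sub_wilsonRun_le {T : V → V} (hT : IsRootedTree r T) {C : ℝ}
    (hC : ∀ s : WilsonState V, |s.value (transition w) T| ≤ C) (k : ℕ) {s : WilsonState V}
    (hs : s.Valid r) :
    |s.value (transition w) T - (wilsonRun w k s (some T)).toReal|
      ≤ C * (wilsonRun w k s none).toReal := by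
  have hP := isWalkToward_transition hT₀ hpos
  induction k generalizing s with
  | zero => simpa [wilsonRun] using hC s
  | succ k ih =>
    by_cases hcur : s.cur ∈ s.visited
    · rcases hq : s.queue with _ | ⟨i, rest⟩
      · rw [wilsonRun_last w _ hcur hq, WilsonState.value_last hP hs hcur hq]
        by_cases h : s.parent = T
        · simp [h, PMF.pure_apply]
        · simp [h, Ne.symm h, PMF.pure_apply]
      · rw [wilsonRun_mark w _ hcur hq, ← WilsonState.value_mark hP hs hcur i rest]
        exact ih (hs.mark hcur hq)
    · have hw := sum_weight_ne_zero hpos fun e : s.cur = r => hcur (e ▸ hs.root_mem)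
      rw [toReal_wilsonRun_move w k hcur hw, toReal_wilsonRun_move w k hcur hw,
        ← WilsonState.sum_value_move hP hs hT hcur, ← Finset.sum_sub_distrib, Finset.mul_sum]
      refine (Finset.abs_sum_le_sum_abs _ _).trans (Finset.sum_le_sum fun v _ => ?_)
      rw [← mul_sub, abs_mul, abs_of_nonneg (hP.nonneg _ _), mul_left_comm]
      exact mul_le_mul_of_nonneg_left (ih (hs.move hcur v)) (hP.nonneg _ _)

/-- The right side bounds the expected remaining time. A walk step lowers the mean of `g` by `1`. A
marking step removes one queue entry, whose `C` pays for that step and for the expected time `g i`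
of the new walk. -/
theorem mul_wilsonRun_none_le {g : V → ℝ} (hg : ∀ y, 0 ≤ g y)
    (hstep : ∀ y, y ≠ r → ∑ v, transition w y v * g v = g y - 1) {C : ℝ} (hC : ∀ y, g y + 1 ≤ C)
    (k : ℕ) {s : WilsonState V} (hs : s.Valid r) :
    k * (wilsonRun w k s none).toReal ≤ g s.cur + C * (s.queue.length + 1) := by
  have hP := isWalkToward_transition hT₀ hpos
  have hC0 : 0 ≤ C := by linarith [hg r, hC r]
  induction k generalizing s with
  | zero =>
    have := hg s.cur
    simp only [Nat.cast_zero, zero_mul]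
    positivity
  | succ k ih =>
    by_cases hcur : s.cur ∈ s.visited
    · rcases hq : s.queue with _ | ⟨i, rest⟩
      · have := hg s.cur
        simp only [wilsonRun_last w _ hcur hq, PMF.pure_apply, reduceCtorEq, if_false,
          ENNReal.toReal_zero, mul_zero]
        positivity
      · rw [wilsonRun_mark w _ hcur hq]
        have h1 := ih (hs.mark hcur hq)
        have h2 : (wilsonRun w k (s.mark i rest) none).toReal ≤ 1 :=
          ENNReal.toReal_le_of_le_ofReal zero_le_one (by simpa using PMF.coe_le_one _ _)
        simp only [WilsonState.mark] at h1 h2 ⊢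
        have h3 := hC i
        have h4 := hg s.cur
        push_cast [List.length_cons]
        linarith
    · have hur : s.cur ≠ r := fun e => hcur (e ▸ hs.root_mem)
      have hw := sum_weight_ne_zero hpos hur
      have h1 : ∑ v, transition w s.cur v * (k * (wilsonRun w k (s.move v) none).toReal)
          ≤ ∑ v, transition w s.cur v * (g v + C * (s.queue.length + 1)) :=
        Finset.sum_le_sum fun v _ =>
          mul_le_mul_of_nonneg_left (ih (hs.move hcur v)) (hP.nonneg _ _)
      have h2 : (wilsonRun w (k + 1) s none).toReal ≤ 1 :=
        ENNReal.toReal_le_of_le_ofReal zero_le_one (by simpa using PMF.coe_le_one _ _)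
      simp only [mul_add (transition w _ _), Finset.sum_add_distrib, hstep _ hur,
        ← Finset.sum_mul, hP.sum_eq_one _ hur, mul_left_comm _ (k : ℝ), ← Finset.mul_sum,
        ← toReal_wilsonRun_move w k hcur hw] at h1
      push_cast
      linarith

theorem tendsto_wilsonRun_none {s : WilsonState V} (hs : s.Valid r) :
    Filter.Tendsto (fun k => (wilsonRun w k s none).toReal) Filter.atTop (𝓝 0) := by
  obtain ⟨g, hg, hstep⟩ := (isWalkToward_transition hT₀ hpos).exists_expected_time
  obtain ⟨C, hC⟩ := (Set.finite_range fun y => g y + 1).bddAbove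
  refine squeeze_zero' (Filter.Eventually.of_forall fun k => ENNReal.toReal_nonneg) ?_
    (tendsto_const_div_atTop_nhds_zero_nat (g s.cur + C * (s.queue.length + 1)))
  filter_upwards [Filter.eventually_gt_atTop 0] with k hk
  rw [le_div_iff₀' (Nat.cast_pos.2 hk)]
  exact mul_wilsonRun_none_le hT₀ hpos hg hstep (fun y => hC ⟨y, rfl⟩) k hs

theorem tendsto_wilsonRun_some {T : V → V} (hT : IsRootedTree r T) {s : WilsonState V}
    (hs : s.Valid r) :
    Filter.Tendsto (fun k => (wilsonRun w k s (some T)).toReal) Filter.atTop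
      (𝓝 (s.value (transition w) T)) := by
  obtain ⟨C, hC⟩ := WilsonState.exists_abs_value_le (transition w) T
  have h := (tendsto_wilsonRun_none hT₀ hpos hs).const_mul C
  rw [mul_zero] at h
  have h' := squeeze_zero_norm
    (fun k => by
      rw [Real.norm_eq_abs]
      exact abs_value_sub_wilsonRun_le hT₀ hpos hT hC k hs) h
  simpa using h'.const_sub (s.value (transition w) T)

end Convergence

/-! ### Wilson's theorem -/

/-- The weight of the tree with root `r` that is given by the parent map `T`. -/
def rootedWeight (w : Matrix V V ℝ≥0) (r : V) (T : V → V) : ℝ≥0 := ∏ u ∈ {r}ᶜ, w (T u) u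

open Classical in
/-- The trees with root `r`. -/
def rootedTrees (r : V) : Finset (V → V) := Finset.univ.filter (IsRootedTree r)

theorem mem_rootedTrees {r : V} {T : V → V} : T ∈ rootedTrees r ↔ IsRootedTree r T := by
  simp [rootedTrees]

omit [Fintype V] in
theorem wilson_state_valid (r : V) {order : List V} (hord : ∀ i, i ∈ order) :
    WilsonState.Valid r
      { visited := {r}, parent := id, start := r, cur := r, queue := order } where
  root_mem := Finset.mem_singleton_self r
  parent_root := rfl
  closed _ hu := hu
  leadsTo _ hu := ⟨0, Finset.mem_singleton.1 hu⟩
  path := .refl _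
  cover u := Or.inr (Or.inr (hord u))

theorem isRootedTree_of_wilson_ne_zero (w : Matrix V V ℝ≥0) {r : V} {order : List V}
    (hord : ∀ i, i ∈ order) {k : ℕ} {T : V → V} (h : wilson w r order k (some T) ≠ 0) :
    IsRootedTree r T :=
  isRootedTree_of_wilsonRun_ne_zero w k (wilson_state_valid r hord) h

theorem exists_positive_tree {w : Matrix V V ℝ≥0} {r : V}
    (hZ : 0 < ∑ T ∈ rootedTrees r, rootedWeight w r T) :
    ∃ T₀, IsRootedTree r T₀ ∧ ∀ u, u ≠ r → 0 < w (T₀ u) u := by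
  obtain ⟨T₀, hT₀, h⟩ := Finset.exists_ne_zero_of_sum_ne_zero hZ.ne'
  refine ⟨T₀, mem_rootedTrees.1 hT₀, fun u hu => pos_iff_ne_zero.2 ?_⟩
  exact Finset.prod_ne_zero_iff.1 h u (by simp [hu])

theorem tendsto_wilson_none {w : Matrix V V ℝ≥0} {r : V} {order : List V}
    (hord : ∀ i, i ∈ order) (hZ : 0 < ∑ T ∈ rootedTrees r, rootedWeight w r T) :
    Filter.Tendsto (fun k => wilson w r order k none) Filter.atTop (𝓝 0) := by
  obtain ⟨T₀, hT₀, hpos⟩ := exists_positive_tree hZ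
  rw [← ENNReal.tendsto_toReal_iff (fun _ => PMF.apply_ne_top _ _) ENNReal.zero_ne_top]
  exact tendsto_wilsonRun_none hT₀ hpos (wilson_state_valid r hord)

/-- **Wilson's theorem**: Wilson's algorithm returns each tree with root `r` with probability
proportional to its weight. -/
theorem tendsto_wilson_some {w : Matrix V V ℝ≥0} {r : V} {order : List V}
    (hord : ∀ i, i ∈ order) (hZ : 0 < ∑ T ∈ rootedTrees r, rootedWeight w r T)
    {T : V → V} (hT : IsRootedTree r T) :
    Filter.Tendsto (fun k => wilson w r order k (some T)) Filter.atTop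
      (𝓝 ((rootedWeight w r T / ∑ T' ∈ rootedTrees r, rootedWeight w r T' : ℝ≥0) : ℝ≥0∞)) := by
  obtain ⟨T₀, hT₀, hpos⟩ := exists_positive_tree hZ
  have hlim : ∀ T, IsRootedTree r T →
      Filter.Tendsto (fun k => (wilson w r order k (some T)).toReal) Filter.atTop
        (𝓝 (treeProb (transition w) T {r})) := by
    intro T hT
    have := tendsto_wilsonRun_some hT₀ hpos hT (wilson_state_valid r hord)
    simpa [WilsonState.value, pathValue_self, hT.1, wilson] using this
  -- The column sums that normalise the draws and the determinant are the same for all `T`.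
  set c : ℝ := ((∏ u ∈ ({r} : Finset V)ᶜ, ((∑ v', w v' u : ℝ≥0) : ℝ))
    * (killed (transition w) {r}).det)⁻¹ with hc
  have hprob : ∀ T, treeProb (transition w) T {r} = rootedWeight w r T * c := by
    intro T
    simp only [treeProb, transition, rootedWeight, Matrix.of_apply, NNReal.coe_div,
      Finset.prod_div_distrib, NNReal.coe_prod, hc]
    rw [div_div, div_eq_mul_inv]
  have hsum : ∀ k, ∑ T ∈ rootedTrees r, (wilson w r order k (some T)).toReal
      = 1 - (wilson w r order k none).toReal := by
    intro k
    have h1 := (wilson w r order k).tsum_coe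
    rw [tsum_fintype, Fintype.sum_option] at h1
    have h2 := congrArg ENNReal.toReal h1
    rw [ENNReal.toReal_add (PMF.apply_ne_top _ _)
      (ENNReal.sum_ne_top.2 fun _ _ => PMF.apply_ne_top _ _),
      ENNReal.toReal_sum fun _ _ => PMF.apply_ne_top _ _, ENNReal.toReal_one] at h2
    rw [← h2, add_sub_cancel_left]
    refine Finset.sum_subset (Finset.subset_univ _) fun T _ hT => ?_
    by_contra h
    refine hT (mem_rootedTrees.2 (isRootedTree_of_wilson_ne_zero w hord (k := k) ?_))
    exact fun h0 => h (by rw [h0, ENNReal.toReal_zero])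
  -- Two limits of the probability of having returned: the sum of the tree limits, and `1` by
  -- termination.
  have htot : ((∑ T' ∈ rootedTrees r, rootedWeight w r T' : ℝ≥0) : ℝ) * c = 1 := by
    have h1 := tendsto_finsetSum (rootedTrees r) fun T hT => hlim T (mem_rootedTrees.1 hT)
    simp only [hsum, hprob, ← Finset.sum_mul, ← NNReal.coe_sum] at h1
    have h2 := (tendsto_wilsonRun_none hT₀ hpos (wilson_state_valid r hord)).const_sub 1
    rw [sub_zero] at h2
    exact tendsto_nhds_unique h1 h2
  rw [← ENNReal.tendsto_toReal_iff (fun _ => PMF.apply_ne_top _ _) ENNReal.coe_ne_top,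
    ENNReal.coe_toReal, NNReal.coe_div, div_eq_mul_inv, inv_eq_of_mul_eq_one_right htot, ← hprob]
  exact hlim T hT

end WilsonLaw

end

/-! ### From rooted trees on the words to dependency trees -/

namespace DependencyGraph

variable {n : ℕ}

theorem attachRoot_eq_zero_iff {r i : Fin n} {T : Fin n → Fin n} :
    attachRoot r T i = 0 ↔ i = r := by
  unfold attachRoot
  split_ifs with h
  · simp [h]
  · simp [h, Fin.succ_ne_zero]

theorem isDependencyTree_attachRoot {r : Fin n} {T : Fin n → Fin n} (hT : IsRootedTree r T) :
    (attachRoot r T).IsDependencyTree := by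
  obtain ⟨d, hd⟩ := hT.exists_rank
  refine ⟨fun v hv => ?_, r, attachRoot_eq_zero_iff.2 rfl, fun i hi => attachRoot_eq_zero_iff.1 hi⟩
  -- The rank shifted by one, leaving `0` for ROOT, increases strictly along every edge and so
  -- forbids cycles.
  let D : Fin (n + 1) → ℕ := Fin.cases 0 fun i => d i + 1
  have hlt : ∀ a b, (attachRoot r T).HasEdge a b → D a < D b := by
    rintro a b ⟨i, rfl, rfl⟩
    unfold attachRoot
    split_ifs with h
    · simp [D]
    · simpa [D] using hd i h
  have key : ∀ a b, Relation.TransGen (attachRoot r T).HasEdge a b → D a < D b := by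
    intro a b h
    induction h with
    | single h => exact hlt _ _ h
    | tail _ h ih => exact ih.trans (hlt _ _ h)
  exact (key v v hv).false

theorem exists_eq_attachRoot {t : ParentMap n} (ht : t.IsDependencyTree) {r : Fin n}
    (hr : t r = 0) : ∃ T, IsRootedTree r T ∧ attachRoot r T = t := by
  have hne : ∀ i, i ≠ r → t i ≠ 0 := fun i hi h => hi (ht.2.unique h hr)
  let T : Fin n → Fin n := fun i => if h : i = r then r else (t i).pred (hne i h)
  have hTr : T r = r := dif_pos rfl
  have hT : ∀ i, i ≠ r → (T i).succ = t i := fun i hi => by simp [T, hi]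
  refine ⟨T, ⟨hTr, ?_⟩, ?_⟩
  · have : Std.Irrefl (Relation.TransGen t.HasEdge) := ⟨ht.1⟩
    -- On a finite set acyclicity gives well-foundedness, hence induction from parents to children.
    have hwf := Finite.wellFounded_of_trans_of_irrefl (Relation.TransGen t.HasEdge)
    have key : ∀ v : Fin (n + 1), ∀ i : Fin n, v = i.succ → ∃ k : ℕ, T^[k] i = r := by
      intro v
      induction v using hwf.induction with
      | _ v ih =>
        rintro i rfl
        by_cases hi : i = r
        · exact ⟨0, hi⟩
        · obtain ⟨k, hk⟩ := ih (t i) (.single ⟨i, rfl, rfl⟩) (T i) (hT i hi).symm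
          exact ⟨k + 1, hk⟩
    exact fun i => key _ i rfl
  · funext i
    unfold attachRoot
    split_ifs with h
    · rw [h, hr]
    · exact hT i h

/-- `attachRoot` forgets only the pointer at `r`, which rooted trees fix by `T r = r`. -/
theorem attachRoot_injOn (r : Fin n) : Set.InjOn (attachRoot r) {T | IsRootedTree r T} := by
  intro T hT T' hT' h
  funext i
  by_cases hi : i = r
  · rw [hi, hT.1, hT'.1]
  · have := congrFun h i
    simpa [attachRoot, hi] using this

variable (G : DependencyGraph n)

theorem treeWeight_attachRoot (r : Fin n) (T : Fin n → Fin n) :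
    G.treeWeight (attachRoot r T) = G.weight 0 r.succ * rootedWeight G.deleteRoot r T := by
  rw [treeWeight, Fintype.prod_eq_mul_prod_compl r, rootedWeight]
  congr 1
  · simp [attachRoot]
  · refine Finset.prod_congr rfl fun i hi => ?_
    have : i ≠ r := by simpa using hi
    simp [attachRoot, this, deleteRoot]

theorem marginal_root (r : Fin n) :
    G.marginal 0 r
      = G.weight 0 r.succ * (∑ T ∈ rootedTrees r, rootedWeight G.deleteRoot r T) / G.partition := by
  rw [marginal, Finset.mul_sum]
  congr 1
  simp only [← treeWeight_attachRoot]
  have himg : (dependencyTrees n).filter (fun t => t r = 0)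
      = (rootedTrees r).image (attachRoot r) := by
    ext t
    simp only [dependencyTrees, Finset.mem_filter, Finset.mem_univ, true_and, Finset.mem_image,
      mem_rootedTrees]
    constructor
    · exact fun h => exists_eq_attachRoot h.1 h.2
    · rintro ⟨T, hT, rfl⟩
      exact ⟨isDependencyTree_attachRoot hT, attachRoot_eq_zero_iff.2 rfl⟩
  rw [himg, Finset.sum_image]
  exact fun T hT T' hT' => attachRoot_injOn r (mem_rootedTrees.1 hT) (mem_rootedTrees.1 hT')

theorem rootedSum_pos_of_marginal_ne_zero {r : Fin n} (h : G.marginal 0 r ≠ 0) :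
    0 < ∑ T ∈ rootedTrees r, rootedWeight G.deleteRoot r T := by
  refine pos_iff_ne_zero.2 fun h0 => h ?_
  rw [marginal_root, h0, mul_zero, zero_div]

/-- Covers the roots that are never drawn, for which Wilson's theorem may not apply: there both
sides of the claim are `0`. -/
theorem treeWeight_eq_zero_of_marginal_eq_zero (hZ : 0 < G.partition) {r : Fin n}
    (h : G.marginal 0 r = 0) {T : Fin n → Fin n} (hT : IsRootedTree r T) :
    G.treeWeight (attachRoot r T) = 0 := by
  rw [treeWeight_attachRoot]
  rw [marginal_root, div_eq_zero_iff, or_iff_left hZ.ne', mul_eq_zero] at h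
  rcases h with h | h
  · rw [h, zero_mul]
  · rw [Finset.sum_eq_zero_iff.1 h T (mem_rootedTrees.2 hT), mul_zero]

theorem treeWeight_attachRoot_div {r : Fin n} (h : G.marginal 0 r ≠ 0) (T : Fin n → Fin n) :
    G.marginal 0 r * (rootedWeight G.deleteRoot r T
      / ∑ T' ∈ rootedTrees r, rootedWeight G.deleteRoot r T')
      = G.treeWeight (attachRoot r T) / G.partition := by
  have hS := (G.rootedSum_pos_of_marginal_ne_zero h).ne'
  rw [marginal_root, treeWeight_attachRoot]
  field_simp

theorem wilsonMarginalRun_apply (hZ : 0 < G.partition) (order : List (Fin n)) (k : ℕ)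
    (o : Option (ParentMap n)) :
    G.wilsonMarginalRun hZ order k o = ∑ r, (G.marginal 0 r : ℝ≥0∞)
      * (wilson G.deleteRoot r order k).map (Option.map (attachRoot r)) o := by
  rw [wilsonMarginalRun, PMF.bind_apply, tsum_fintype]
  rfl

variable {G} {order : List (Fin n)} (hord : ∀ i, i ∈ order)
include hord

theorem exists_of_map_wilson_ne_zero {r : Fin n} {k : ℕ} {t : ParentMap n}
    (h : (wilson G.deleteRoot r order k).map (Option.map (attachRoot r)) (some t) ≠ 0) :
    ∃ T, IsRootedTree r T ∧ attachRoot r T = t := by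
  rw [← PMF.mem_support_iff, PMF.mem_support_map_iff] at h
  obtain ⟨o, ho, hot⟩ := h
  obtain ⟨T, rfl, hT⟩ := Option.map_eq_some_iff.1 hot
  exact ⟨T, isRootedTree_of_wilson_ne_zero _ hord ((PMF.mem_support_iff _ _).1 ho), hT⟩

theorem map_wilson_attachRoot (r : Fin n) (k : ℕ) {T : Fin n → Fin n} (hT : IsRootedTree r T) :
    (wilson G.deleteRoot r order k).map (Option.map (attachRoot r)) (some (attachRoot r T))
      = wilson G.deleteRoot r order k (some T) := by
  rw [PMF.map_apply, tsum_eq_single (some T)]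
  · simp
  · rintro (_ | T') hne
    · simp
    · rw [Option.map_some]
      split_ifs with h
      · by_contra h0
        have hT' := isRootedTree_of_wilson_ne_zero _ hord h0
        exact hne (congrArg some (attachRoot_injOn r hT' hT (Option.some_injective _ h).symm))
      · rfl

theorem wilsonMarginalRun_attachRoot (hZ : 0 < G.partition) (k : ℕ) {r : Fin n}
    {T : Fin n → Fin n} (hT : IsRootedTree r T) :
    G.wilsonMarginalRun hZ order k (some (attachRoot r T))
      = G.marginal 0 r * wilson G.deleteRoot r order k (some T) := by
  rw [wilsonMarginalRun_apply, Finset.sum_eq_single r, map_wilson_attachRoot hord r k hT]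
  -- A tree determines its root word, so draws of any other word contribute nothing.
  · intro r' _ hr'
    refine mul_eq_zero_of_right _ ?_
    by_contra h
    obtain ⟨T', -, h'⟩ := exists_of_map_wilson_ne_zero hord h
    refine hr' (attachRoot_eq_zero_iff (T := T) |>.1 ?_)
    rw [← h', attachRoot_eq_zero_iff]
  · simp

theorem wilsonMarginalProb_attachRoot (hZ : 0 < G.partition) {r : Fin n} {T : Fin n → Fin n}
    (hT : IsRootedTree r T) :
    G.wilsonMarginalProb hZ order (attachRoot r T)
      = ((G.treeWeight (attachRoot r T) / G.partition : ℝ≥0) : ℝ≥0∞) := by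
  simp only [wilsonMarginalProb, wilsonMarginalRun_attachRoot hord hZ _ hT]
  by_cases h : G.marginal 0 r = 0
  · simp [h, G.treeWeight_eq_zero_of_marginal_eq_zero hZ h hT]
  · have hmono : Monotone fun k => wilson G.deleteRoot r order k (some T) :=
      monotone_nat_of_le_succ fun k => wilsonRun_mono _ T k _
    -- By monotonicity the supremum over `k` is the limit found in Wilson's theorem.
    rw [← ENNReal.mul_iSup, tendsto_nhds_unique (tendsto_atTop_iSup hmono)
      (tendsto_wilson_some hord (G.rootedSum_pos_of_marginal_ne_zero h) hT), ← ENNReal.coe_mul,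
      G.treeWeight_attachRoot_div h]

theorem wilsonMarginalProb_of_not_isDependencyTree (hZ : 0 < G.partition) {t : ParentMap n}
    (ht : ¬ t.IsDependencyTree) : G.wilsonMarginalProb hZ order t = 0 := by
  refine ENNReal.iSup_eq_zero.2 fun k => ?_
  rw [wilsonMarginalRun_apply]
  refine Finset.sum_eq_zero fun r _ => mul_eq_zero_of_right _ ?_
  by_contra h
  obtain ⟨T, hT, rfl⟩ := exists_of_map_wilson_ne_zero hord h
  exact ht (isDependencyTree_attachRoot hT)

theorem tendsto_wilsonMarginalRun_none (hZ : 0 < G.partition) :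
    Filter.Tendsto (fun k => G.wilsonMarginalRun hZ order k none) Filter.atTop (𝓝 0) := by
  have hmap : ∀ (r : Fin n) k,
      (wilson G.deleteRoot r order k).map (Option.map (attachRoot r)) none
        = wilson G.deleteRoot r order k none := by
    intro r k
    rw [PMF.map_apply, tsum_eq_single none]
    · simp
    · rintro (_ | T) h
      · exact absurd rfl h
      · simp
  simp only [wilsonMarginalRun_apply, hmap]
  have hterm : ∀ r : Fin n, Filter.Tendsto (fun k =>
      (G.marginal 0 r : ℝ≥0∞) * wilson G.deleteRoot r order k none) Filter.atTop (𝓝 0) := by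
    intro r
    by_cases h : G.marginal 0 r = 0
    · simp [h]
    · have := ENNReal.Tendsto.const_mul (a := (G.marginal 0 r : ℝ≥0∞))
        (tendsto_wilson_none hord (G.rootedSum_pos_of_marginal_ne_zero h))
        (Or.inr ENNReal.coe_ne_top)
      simpa using this
  simpa using tendsto_finsetSum Finset.univ fun r _ => hterm r

end DependencyGraph

/-- WilsonMarginal is unbiased: whatever the order in which Wilson's algorithm processes the words,
each dependency tree `t` is returned with probability `φ(t) / Z_D`, nothing but dependency trees
is returned, and the algorithm terminates almost surely. -/
theorem mainTheorem1 {n : ℕ} (G : DependencyGraph n) (hZ : 0 < G.partition)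
    (order : List (Fin n)) (hord : ∀ i : Fin n, i ∈ order) :
    (∀ t : ParentMap n, t.IsDependencyTree →
      G.wilsonMarginalProb hZ order t = ((G.treeWeight t / G.partition : ℝ≥0) : ℝ≥0∞)) ∧
    (∀ t : ParentMap n, ¬ t.IsDependencyTree → G.wilsonMarginalProb hZ order t = 0) ∧
    Filter.Tendsto (fun k : ℕ => G.wilsonMarginalRun hZ order k none) Filter.atTop (𝓝 0) := by
  refine ⟨fun t ht => ?_,
    fun t ht => DependencyGraph.wilsonMarginalProb_of_not_isDependencyTree hord hZ ht,
    DependencyGraph.tendsto_wilsonMarginalRun_none hord hZ⟩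
  obtain ⟨r, hr, -⟩ := ht.2
  obtain ⟨T, hT, rfl⟩ := DependencyGraph.exists_eq_attachRoot ht hr
  exact DependencyGraph.wilsonMarginalProb_attachRoot hord hZ hT
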